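/- A dessin $\mathbb{D}$ is a finite multigraph (loops and multiple edges allowed) with a cyclic order of the half-edges at every vertex; $v,e,f,k$ denote its numbers of vertices, edges, faces and connected components, and its genus $g$ is given by $v-e+f=2k-2g$. A spanning $j$-quasi-tree of $\mathbb{D}$ is a connected spanning sub-dessin $\mathbb{H}$ (obtained by deleting edges) of genus $j$ with $f(\mathbb{H})=1$ and $e(\mathbb{H})=v(\mathbb{H})-1+2j$; let $s(j,\mathbb{D})$ be the number of these. A dessin with one vertex is the same as a chord diagram: the vertex is the circle and the edges are the chords. Fix a base point on the circle, disjoint from the chords, and number the chords consecutively in the order in which they are first met from the base point. The intersection matrix ${\rm IM}(\mathbb{D})$ has entry $\operatorname{sign}(i-j)$ at $(i,j)$ if the $i$-th and the $j$-th chord intersect, and $0$ otherwise. Theorem. For every dessin $\mathbb{D}$ with one vertex and $m=e(\mathbb{D})$ edges, and every choice of the base point, $$\det({\rm IM}(\mathbb{D}) - x I) = (-1)^{m} \sum_{j=0}^{\lfloor m/2 \rfloor} s(j,\mathbb{D})\, x^{m-2j}.$$ In particular, let $P$ be a connected planar diagram of a link $K$ such that its all-$A$ splicing consists of a single circle, and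 let $\mathbb{D}=\mathbb{D}(A)$ be the all-$A$ dessin of $P$: its vertex is that circle, its edges are the crossings of $P$, and the cyclic order is the order in which the circle passes the crossings. Then the determinant $\det(K)=|J_K(-1)|$, where $J_K$ is the Jones polynomial of $K$ (computed from the Kauffman bracket of $P$), satisfies $$\det(K) = \left|\det\left({\rm IM}(\mathbb{D}) - \sqrt{-1}\, I\right)\right|.$$ -/

import Mathlib

open Polynomial

noncomputable section

/-! ## Dessins (oriented ribbon graphs) -/

/-- A dessin with vertex set `V` and edge set `E`: a multigraph (loops and multiple edges allowed)
with a cyclic order of the half-edges at every vertex.  The two half-edges of `e` are `(e, false)`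
and `(e, true)`; `vert` is the vertex at which a half-edge is attached; the cycles of `rot` are
exactly the cyclic orders around the vertices.  Vertices without half-edges are allowed. -/
structure Dessin (V E : Type*) where
  rot : Equiv.Perm (E × Bool)
  vert : E × Bool → V
  sameCycle_iff : ∀ h k, rot.SameCycle h k ↔ vert h = vert k

/-- The exchange of the two ends of every edge. -/
def halfEdgeFlip (E : Type*) : Equiv.Perm (E × Bool) where
  toFun h := (h.1, !h.2)
  invFun h := (h.1, !h.2)
  left_inv h := by simp
  right_inv h := by simp

/-! ### First-return permutations, used for deleting edges -/

section FirstReturn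

variable {α β : Type*} [Finite α] (σ : Equiv.Perm α) (ι : β ↪ α)

theorem exists_return (b : β) : ∃ n : ℕ, 0 < n ∧ ∃ c, (σ ^ n) (ι b) = ι c :=
  ⟨orderOf σ, orderOf_pos σ, b, by rw [pow_orderOf_eq_one]; rfl⟩

open Classical in
/-- The least `n > 0` for which `σ ^ n` brings `ι b` back to the range of `ι`. -/
def returnTime (b : β) : ℕ := Nat.find (exists_return σ ι b)

theorem returnTime_pos (b : β) : 0 < returnTime σ ι b := by
  classical
  exact (Nat.find_spec (exists_return σ ι b)).1

theorem returnTime_le {b c : β} {n : ℕ} (hn : 0 < n) (h : (σ ^ n) (ι b) = ι c) :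
    returnTime σ ι b ≤ n := by
  classical
  exact Nat.find_min' (exists_return σ ι b) ⟨hn, c, h⟩

theorem exists_returnPoint (b : β) : ∃ c, (σ ^ returnTime σ ι b) (ι b) = ι c := by
  classical
  exact (Nat.find_spec (exists_return σ ι b)).2

/-- The first point of the range of `ι` met after `ι b` along the cycle of `σ`. -/
def returnPoint (b : β) : β := (exists_returnPoint σ ι b).choose

theorem pow_returnTime (b : β) : (σ ^ returnTime σ ι b) (ι b) = ι (returnPoint σ ι b) :=
  (exists_returnPoint σ ι b).choose_spec

theorem returnPoint_injective : Function.Injective (returnPoint σ ι) := by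
  have key : ∀ b c, returnPoint σ ι b = returnPoint σ ι c →
      returnTime σ ι b ≤ returnTime σ ι c → b = c := by
    intro b c h hle
    have e : (σ ^ returnTime σ ι b) (ι b) = (σ ^ returnTime σ ι c) (ι c) := by
      rw [pow_returnTime, pow_returnTime, h]
    have e2 : ι b = (σ ^ (returnTime σ ι c - returnTime σ ι b)) (ι c) := by
      apply (σ ^ returnTime σ ι b).injective
      rw [e, ← Equiv.Perm.mul_apply, ← pow_add, Nat.add_sub_cancel' hle]
    rcases Nat.eq_zero_or_pos (returnTime σ ι c - returnTime σ ι b) with h0 | h0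
    · rw [h0] at e2
      exact ι.injective e2
    · have h1 := returnTime_le σ ι h0 e2.symm
      have h2 := returnTime_pos σ ι b
      omega
  intro b c h
  rcases le_total (returnTime σ ι b) (returnTime σ ι c) with hle | hle
  · exact key b c h hle
  · exact (key c b h.symm hle).symm

/-- The permutation that `σ` induces on a subset: skip the points outside the subset. -/
def firstReturn : Equiv.Perm β :=
  haveI : Finite β := Finite.of_injective ι ι.injective
  Equiv.ofBijective (returnPoint σ ι) (Finite.injective_iff_bijective.mp (returnPoint_injective σ ι))

theorem firstReturn_apply (b : β) : firstReturn σ ι b = returnPoint σ ι b := rfl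

theorem sameCycle_firstReturn (b c : β) :
    (firstReturn σ ι).SameCycle b c ↔ σ.SameCycle (ι b) (ι c) := by
  have : Finite β := Finite.of_injective ι ι.injective
  constructor
  · intro h
    classical
    have : Fintype β := Fintype.ofFinite β
    obtain ⟨n, -, -, rfl⟩ := h.exists_pow_eq
    clear h
    induction n with
    | zero => exact Equiv.Perm.SameCycle.refl _ _
    | succ n ih =>
      refine ih.trans ?_
      rw [pow_succ', Equiv.Perm.mul_apply, firstReturn_apply, ← pow_returnTime]
      exact ⟨(returnTime σ ι _ : ℕ), by rw [zpow_natCast]⟩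
  · intro h
    classical
    have : Fintype α := Fintype.ofFinite α
    obtain ⟨n, -, -, hn⟩ := h.exists_pow_eq
    clear h
    induction n using Nat.strong_induction_on generalizing b with
    | _ n ih =>
      rcases Nat.eq_zero_or_pos n with rfl | hpos
      · have : b = c := ι.injective (by simpa using hn)
        subst this
        exact Equiv.Perm.SameCycle.refl _ _
      · have hle := returnTime_le σ ι hpos hn
        have hp := returnTime_pos σ ι b
        have h1 : (σ ^ (n - returnTime σ ι b)) (ι (returnPoint σ ι b)) = ι c := by
          rw [← pow_returnTime, ← Equiv.Perm.mul_apply, ← pow_add, Nat.sub_add_cancel hle, hn]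
        have h2 := ih (n - returnTime σ ι b) (by omega) (returnPoint σ ι b) h1
        rw [← firstReturn_apply] at h2
        exact (Equiv.Perm.sameCycle_apply_left).mp h2

end FirstReturn

namespace Dessin

variable {V E : Type*}

/-- The number of vertices. -/
def v (_ : Dessin V E) : ℕ := Nat.card V

/-- The number of edges. -/
def e (_ : Dessin V E) : ℕ := Nat.card E

/-- The face permutation: walk along an edge, then turn to the next half-edge. -/
def faceRot (D : Dessin V E) : Equiv.Perm (E × Bool) := D.rot * halfEdgeFlip E

/-- The number of faces: the cycles of the face permutation, and one face for every vertex
that has no half-edge (such a vertex is a sphere component with a single disk face). -/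
def f (D : Dessin V E) : ℕ :=
  Nat.card (Quotient (Equiv.Perm.SameCycle.setoid D.faceRot)) +
    Nat.card {x : V // ∀ h, D.vert h ≠ x}

/-- The number of connected components of the underlying multigraph. -/
def k (D : Dessin V E) : ℕ :=
  Nat.card (Quot fun x y : V => ∃ a : E, D.vert (a, false) = x ∧ D.vert (a, true) = y)

/-- The genus (the numerator is always even). -/
def genus (D : Dessin V E) : ℤ := (2 * D.k - D.v + D.e - D.f) / 2

/-- The inclusion of the half-edges of the edges in `S`. -/
def halfEdgeEmb (S : Set E) : (S × Bool) ↪ (E × Bool) where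
  toFun h := (h.1, h.2)
  inj' := by
    rintro ⟨⟨a, ha⟩, b⟩ ⟨⟨a', ha'⟩, b'⟩ h
    simpa using h

/-- The spanning sub-dessin with edge set `S`: same vertices, the edges outside `S` are deleted,
the cyclic orders are the induced ones. -/
def sub [Finite E] (D : Dessin V E) (S : Set E) : Dessin V S where
  rot := firstReturn D.rot (halfEdgeEmb S)
  vert h := D.vert (halfEdgeEmb S h)
  sameCycle_iff h k := by rw [sameCycle_firstReturn, D.sameCycle_iff]

/-- `H` is a quasi-tree of genus `j`: connected, of genus `j`, with one face, and with
`v(H) - 1 + 2 j` edges. -/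
def IsQuasiTree (H : Dessin V E) (j : ℕ) : Prop :=
  H.k = 1 ∧ H.genus = j ∧ H.f = 1 ∧ H.e + 1 = H.v + 2 * j

/-- The number `s(j, D)` of spanning `j`-quasi-trees of `D`. -/
def s [Finite E] (j : ℕ) (D : Dessin V E) : ℕ :=
  Set.ncard {S : Set E | (D.sub S).IsQuasiTree j}

/-- The choices made to write down the intersection matrix of a one-vertex dessin, seen as a chord
diagram.  The end points of the chords are listed along the circle, starting from a base point
(`point`), and the chords are numbered consecutively in the order in which they are first
met from the base point (`chord`). -/
structure ChordNumbering (D : Dessin V E) where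
  point : Fin (Nat.card (E × Bool)) ≃ E × Bool
  rot_point : ∀ i, D.rot (point i) = point (finRotate _ i)
  chord : Fin (Nat.card E) ≃ E
  chord_strictMono : StrictMono fun i =>
    min (point.symm (chord i, false)) (point.symm (chord i, true))

namespace ChordNumbering

variable {D : Dessin V E} (N : D.ChordNumbering)

/-- The first end point of a chord, seen from the base point. -/
def lo (a : E) : Fin (Nat.card (E × Bool)) := min (N.point.symm (a, false)) (N.point.symm (a, true))

/-- The second end point of a chord, seen from the base point. -/
def hi (a : E) : Fin (Nat.card (E × Bool)) := max (N.point.symm (a, false)) (N.point.symm (a, true))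

/-- Two chords intersect: their end points alternate on the circle. -/
def Intersect (a b : E) : Prop :=
  (N.lo a < N.lo b ∧ N.lo b < N.hi a ∧ N.hi a < N.hi b) ∨
    (N.lo b < N.lo a ∧ N.lo a < N.hi b ∧ N.hi b < N.hi a)

open Classical in
/-- The signed intersection matrix. -/
def IM : Matrix (Fin (Nat.card E)) (Fin (Nat.card E)) ℤ := fun i j =>
  if N.Intersect (N.chord i) (N.chord j) then Int.sign ((i : ℤ) - (j : ℤ)) else 0

end ChordNumbering

end Dessin

/-! ## Link diagrams -/

/-- An oriented link diagram with crossing set `C` on the sphere, as a combinatorial map.  The four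
ends at the crossing `c` are `(c, 0), (c, 1), (c, 2), (c, 3)` in counterclockwise order; the under
strand joins `(c, 0)` and `(c, 2)`, the over strand joins `(c, 1)` and `(c, 3)`.  `pair` matches the
two ends of every arc of the projection, `loops` is the number of components without crossings,
`incoming` is the orientation of the link (`true` at the ends pointing towards the crossing).
`planar` is Euler's formula `V - E + F = 2 k` for the projection, with `V = #C` and `E = 2 #C`. -/
structure LinkDiagram (C : Type*) where
  pair : Equiv.Perm (C × ZMod 4)
  pair_pair : ∀ d, pair (pair d) = d
  pair_ne : ∀ d, pair d ≠ d
  loops : ℕ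
  incoming : C × ZMod 4 → Bool
  incoming_pair : ∀ d, incoming (pair d) = !incoming d
  incoming_opp : ∀ c i, incoming (c, i + 2) = !incoming (c, i)
  planar :
    Nat.card (Quotient (Equiv.Perm.SameCycle.setoid
        ((Equiv.prodCongr (Equiv.refl C) (Equiv.addRight (1 : ZMod 4)) :
          Equiv.Perm (C × ZMod 4)) * pair))) =
      Nat.card C + 2 * Nat.card (Quot fun c c' : C => ∃ i i', pair (c, i) = (c', i'))

namespace LinkDiagram

variable {C : Type*}

/-- The projection is connected. -/
def IsConnected (P : LinkDiagram C) : Prop :=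
  Nat.card (Quot fun c c' : C => ∃ i i', P.pair (c, i) = (c', i')) + P.loops = 1

/-- The splicing of a crossing, as a matching of its four ends.  The `A`-splicing (`true`) opens the
two regions swept out by the over strand when it is turned counterclockwise: it joins `0` with `1`
and `2` with `3`.  The `B`-splicing (`false`) joins `0` with `3` and `1` with `2`. -/
def splice (s : C → Bool) (d : C × ZMod 4) : C × ZMod 4 :=
  (d.1, if s d.1 then 1 - d.2 else 3 - d.2)

/-- The circles of a state that pass through some crossing. -/
def Circle (P : LinkDiagram C) (s : C → Bool) : Type _ :=
  Quot fun d d' : C × ZMod 4 => d' = P.pair d ∨ d' = splice s d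

/-- The circle of a state through an end. -/
def circleAt (P : LinkDiagram C) (s : C → Bool) (d : C × ZMod 4) : P.Circle s := Quot.mk _ d

theorem circleAt_pair (P : LinkDiagram C) (s : C → Bool) (d : C × ZMod 4) :
    P.circleAt s (P.pair d) = P.circleAt s d :=
  (Quot.sound (r := fun d d' : C × ZMod 4 => d' = P.pair d ∨ d' = splice s d) (Or.inl rfl)).symm

theorem circleAt_splice (P : LinkDiagram C) (s : C → Bool) (d : C × ZMod 4) :
    P.circleAt s (splice s d) = P.circleAt s d :=
  (Quot.sound (r := fun d d' : C × ZMod 4 => d' = P.pair d ∨ d' = splice s d) (Or.inr rfl)).symm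

/-- The number of circles of a state. -/
def circles (P : LinkDiagram C) (s : C → Bool) : ℕ := Nat.card (P.Circle s) + P.loops

open LaurentPolynomial in
/-- The Kauffman bracket in the variable `A = T 1`, with value `1` on the circle without
crossings. -/
def bracket [Fintype C] [DecidableEq C] (P : LinkDiagram C) : LaurentPolynomial ℤ :=
  ∑ s : C → Bool,
    T (∑ c, if s c then 1 else -1) * (-T 2 - T (-2)) ^ (P.circles s - 1)

/-- The sign of a crossing: `+1` if turning the over strand counterclockwise by less than a half
turn brings it onto the under strand with the same direction, `-1` otherwise. -/
def crossingSign (P : LinkDiagram C) (c : C) : ℤ :=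
  if P.incoming (c, 0) = P.incoming (c, 3) then 1 else -1

/-- The writhe. -/
def writhe [Fintype C] (P : LinkDiagram C) : ℤ := ∑ c, P.crossingSign c

open LaurentPolynomial in
/-- The Jones polynomial `(-A ^ 3) ^ (-w) * ⟨P⟩`, written in the variable `A`, where
`t = A ^ (-4)`. -/
def jones [Fintype C] [DecidableEq C] (P : LinkDiagram C) : LaurentPolynomial ℤ :=
  LaurentPolynomial.C (Int.negOnePow P.writhe : ℤ) * T (-3 * P.writhe) * P.bracket

/-- The eighth root of unity `exp (π i / 4)`, a value of `A` for which `t = A ^ (-4) = -1`. -/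
def rootA : ℂˣ := Units.mk0 (Complex.exp (Real.pi * Complex.I / 4)) (Complex.exp_ne_zero _)

/-- The determinant of the link: the absolute value of its Jones polynomial at `t = -1`. -/
def determinant [Fintype C] [DecidableEq C] (P : LinkDiagram C) : ℝ :=
  ‖LaurentPolynomial.eval₂ (Int.castRingHom ℂ) rootA P.jones‖

/-! ### The dessin of the all-`A` state -/

/-- The all-`A` state. -/
def allA (C : Type*) : C → Bool := fun _ => true

/-- A choice of a direction for every circle of the all-`A` state: `out d` says that the circle
through the end `d` runs away from the crossing at `d`. -/
structure CircleOrientation (P : LinkDiagram C) where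
  out : C × ZMod 4 → Bool
  out_pair : ∀ d, out (P.pair d) = !out d
  out_splice : ∀ d, out (splice (allA C) d) = !out d

/-- The arc of the all-`A` state at an end: at each crossing `c` the arc `(c, false)` joins the ends
`0` and `1`, the arc `(c, true)` joins the ends `2` and `3`. -/
def arc (d : C × ZMod 4) : C × Bool := (d.1, decide (d.2 = 2 ∨ d.2 = 3))

/-- One of the two ends of an arc. -/
def arcEnd (a : C × Bool) : C × ZMod 4 := (a.1, if a.2 then 2 else 0)

theorem splice_splice (d : C × ZMod 4) : splice (allA C) (splice (allA C) d) = d := by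
  simp [splice, allA]

theorem arc_splice (d : C × ZMod 4) : arc (splice (allA C) d) = arc d := by
  obtain ⟨c, i⟩ := d
  have : ∀ i : ZMod 4, decide (1 - i = 2 ∨ 1 - i = 3) = decide (i = 2 ∨ i = 3) := by decide
  simp only [arc, splice, allA, if_true]
  rw [this]

theorem arc_arcEnd (a : C × Bool) : arc (arcEnd a) = a := by
  obtain ⟨c, b⟩ := a
  have : ∀ b : Bool, decide ((if b then (2 : ZMod 4) else 0) = 2 ∨
    (if b then (2 : ZMod 4) else 0) = 3) = b := by decide
  exact Prod.ext rfl (this b)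

theorem arcEnd_arc (d : C × ZMod 4) :
    arcEnd (arc d) = d ∨ arcEnd (arc d) = splice (allA C) d := by
  obtain ⟨c, i⟩ := d
  have : ∀ i : ZMod 4, (if decide (i = 2 ∨ i = 3) then (2 : ZMod 4) else 0) = i ∨
    (if decide (i = 2 ∨ i = 3) then (2 : ZMod 4) else 0) = 1 - i := by decide
  simp only [arc, arcEnd, splice, allA, if_true, Prod.mk.injEq, true_and]
  exact this i

namespace CircleOrientation

variable {P : LinkDiagram C} (O : P.CircleOrientation)

/-- The end with `out = b` of an arc: `b = true` is the end at which the circle leaves the arc,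
`b = false` the end at which it enters the arc. -/
def endOf (b : Bool) (a : C × Bool) : C × ZMod 4 :=
  if O.out (arcEnd a) = b then arcEnd a else splice (allA C) (arcEnd a)

theorem arc_endOf (b : Bool) (a : C × Bool) : arc (O.endOf b a) = a := by
  unfold endOf
  split_ifs
  · exact arc_arcEnd a
  · rw [arc_splice, arc_arcEnd]

theorem out_endOf (b : Bool) (a : C × Bool) : O.out (O.endOf b a) = b := by
  unfold endOf
  split_ifs with h
  · exact h
  · rw [O.out_splice]
    cases b <;> simpa using h

theorem endOf_arc (d : C × ZMod 4) : O.endOf (O.out d) (arc d) = d := by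
  unfold endOf
  rcases arcEnd_arc d with h | h
  · rw [h, if_pos rfl]
  · rw [h, O.out_splice, if_neg (by simp), splice_splice]

/-- The next arc along (`true`) or against (`false`) the direction of the circles. -/
def step (b : Bool) (a : C × Bool) : C × Bool := arc (P.pair (O.endOf b a))

theorem step_step (b : Bool) (a : C × Bool) : O.step (!b) (O.step b a) = a := by
  have h : O.out (P.pair (O.endOf b a)) = !b := by rw [O.out_pair, O.out_endOf]
  unfold step
  conv_lhs => rw [← h, O.endOf_arc, P.pair_pair, O.arc_endOf]

/-- The permutation of the arcs that follows the directed circles. -/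
def nextArc : Equiv.Perm (C × Bool) where
  toFun := O.step true
  invFun := O.step false
  left_inv a := O.step_step true a
  right_inv a := O.step_step false a

theorem sameCycle_pair (d : C × ZMod 4) : O.nextArc.SameCycle (arc d) (arc (P.pair d)) := by
  have key : ∀ d, O.out d = true → O.nextArc (arc d) = arc (P.pair d) := by
    intro d h
    change arc (P.pair (O.endOf true (arc d))) = _
    rw [← h, O.endOf_arc]
  cases h : O.out d
  · have h2 := key (P.pair d) (by rw [O.out_pair, h]; rfl)
    rw [P.pair_pair] at h2
    refine Equiv.Perm.SameCycle.symm ⟨1, ?_⟩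
    simpa using h2
  · exact ⟨1, by simpa using key d h⟩

theorem circleAt_nextArc (a : C × Bool) :
    P.circleAt (allA C) (arcEnd (O.nextArc a)) = P.circleAt (allA C) (arcEnd a) := by
  have harc : ∀ d : C × ZMod 4,
      P.circleAt (allA C) (arcEnd (arc d)) = P.circleAt (allA C) d := by
    intro d
    rcases arcEnd_arc d with h | h
    · rw [h]
    · rw [h, circleAt_splice]
  change P.circleAt (allA C) (arcEnd (arc (P.pair (O.endOf true a)))) = _
  rw [harc, circleAt_pair, ← harc, O.arc_endOf]

theorem sameCycle_nextArc_iff (a b : C × Bool) : O.nextArc.SameCycle a b ↔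
    P.circleAt (allA C) (arcEnd a) = P.circleAt (allA C) (arcEnd b) := by
  constructor
  · rintro ⟨n, rfl⟩
    induction n with
    | zero => rfl
    | succ n ih =>
      rw [add_comm, zpow_one_add, Equiv.Perm.mul_apply, O.circleAt_nextArc, ← ih]
    | pred n ih =>
      rw [ih, ← O.circleAt_nextArc ((O.nextArc ^ (-(n : ℤ) - 1)) a), ← Equiv.Perm.mul_apply,
        ← zpow_one_add, add_sub_cancel]
  · intro h
    let q : P.Circle (allA C) → Quotient (Equiv.Perm.SameCycle.setoid O.nextArc) :=
      Quot.lift (fun d => Quotient.mk _ (arc d)) (by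
        rintro d d' (rfl | rfl)
        · exact Quotient.sound (O.sameCycle_pair d)
        · rw [arc_splice])
    have h2 : q (P.circleAt _ (arcEnd a)) = q (P.circleAt _ (arcEnd b)) := congrArg q h
    change Quotient.mk _ (arc (arcEnd a)) = Quotient.mk _ (arc (arcEnd b)) at h2
    rw [arc_arcEnd, arc_arcEnd] at h2
    exact Quotient.exact h2

end CircleOrientation

/-- The dessin of the all-`A` state: its vertices are the state circles, its edges are the
crossings, the half-edges of a crossing are its two arcs, and the cyclic orders are given by the
directions of the circles.  (When there is only one circle, each of its two directions is the
counterclockwise one for some choice of the point at infinity.) -/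
def allADessin (P : LinkDiagram C) (O : P.CircleOrientation) :
    Dessin (P.Circle (allA C) ⊕ Fin P.loops) C where
  rot := O.nextArc
  vert a := Sum.inl (P.circleAt (allA C) (arcEnd a))
  sameCycle_iff a b := by
    simpa using O.sameCycle_nextArc_iff a b

end LinkDiagram

end

/-!
Let `D` be a dessin with one vertex and `m` edges, and let `S` be a set of edges. Everything is
expressed through one condition on `S`, `Dessin.Unicursal`: the boundary walk `rot * flipOn S`,
which crosses the edges in `S` and ignores the others, is a single cycle on the half-edges.

*Quasi-trees.* As there is only one vertex, `f (D.sub S) = 1` holds exactly when `S` is unicursal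
(`Dessin.f_sub_eq_one_iff`), so that the quasi-trees of genus `j` are the unicursal sets with `2 j`
edges. A unicursal set has an even number of edges, because `rot` and `rot * flipOn S` are both
cyclic permutations of all half-edges and hence have the same sign.

*Determinant.* The characteristic polynomial is the sum of the principal minors of `IM`, weighted by
powers of `-x`, and the minor for `S` is `1` if `S` is unicursal and `0` otherwise
(`ChordNumbering.minor_eq`). To see this, let `M` be the incidence matrix of chords and end points,
with `1` at the first and `-1` at the second end of a chord, and let `Θ` be the strictly lower
triangular matrix of ones, indexed by the end points in their order on the circle. Then
`IM = 1 + M Θ Mᵀ`. If `Δ` is the projection to the chords in `S`, then `Mᵀ Δ M = 1 - F` with the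
permutation matrix `F` of `flipOn S`, and Sylvester's identity turns the minor into
`det (1 + (1 - F) Θ)`. Multiplying by `det (1 - N) = 1`, where `N` is the shift along the circle cut
open at the base point, and using `Θ (1 - N) = N`, gives `det (1 - F N)`. Now `F N` is the
permutation matrix of a boundary walk with one row deleted. If the walk is a single cycle, `F N` is
strictly triangular in a suitable order and the determinant is `1`; any other cycle survives and
contributes a vector in the kernel of `1 - F N`.

*Links.* At `A = exp (π i / 4)` the factor `-A ^ 2 - A ^ (-2)` of a circle vanishes, so only the
states with a single circle contribute to the bracket. If `S` is the set of crossings with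
`B`-splicing, the state is a single circle exactly when `S` is unicursal in the all-`A` dessin
(`LinkDiagram.circles_sub_one_eq_zero_iff`), and as `|S|` is even, the summands on both sides of
`det K = |det (IM - i)|` agree up to a common factor of absolute value `1`. The comparison of state
circles and boundary walks needs that the direction of the all-`A` circle is alternately outgoing
and incoming around every crossing, and here planarity enters: the faces of the projection have a
checkerboard colouring (`LinkDiagram.exists_checkerboard`), with which the direction agrees up to a
global sign. The colouring exists since the first cohomology of a planar map with coefficients in
`ZMod 2` vanishes, which is proved by counting dimensions with Euler's formula
(`exists_edgeSum_eq`).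
-/

noncomputable section

/-! ### Determinants of permutation matrices with a deleted row -/

section Determinants

open Matrix

variable {α R : Type*} [Fintype α] [DecidableEq α] [CommRing R]

/-- Deleting the row of `a` from the matrix of a single cycle leaves a matrix that is strictly
triangular when the points are ordered by their number of steps to `a`. -/
theorem det_one_sub_of_sameCycle (τ : Equiv.Perm α) (a : α) (h : ∀ b, τ.SameCycle a b) :
    (1 - Matrix.of fun i j => if i = a then (0 : R) else if j = τ i then 1 else 0).det = 1 := by
  classical
  have hex : ∀ b, ∃ n : ℕ, (τ ^ n) b = a := fun b => by
    obtain ⟨n, -, -, hn⟩ := (h b).symm.exists_pow_eq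
    exact ⟨n, hn⟩
  -- the number of steps to `a`
  let r : α → ℕ := fun b => Nat.find (hex b)
  have hr : ∀ b, (τ ^ r b) b = a := fun b => Nat.find_spec (hex b)
  have hlt : ∀ b, b ≠ a → r (τ b) < r b := by
    intro b hb
    have h0 : r b ≠ 0 := by
      intro h0
      have := hr b
      rw [h0] at this
      exact hb this
    obtain ⟨k, hk⟩ := Nat.exists_eq_succ_of_ne_zero h0
    have h1 : (τ ^ k) (τ b) = a := by
      have := hr b
      rwa [hk, pow_succ] at this
    have : r (τ b) ≤ k := Nat.find_min' (hex (τ b)) h1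
    omega
  have hinj : Function.Injective r := by
    intro b c hbc
    have := (hr b).trans (hr c).symm
    rw [hbc] at this
    exact (τ ^ r c).injective this
  let _ : LinearOrder α := LinearOrder.lift' r hinj
  have hτ : ∀ b, b ≠ a → τ b ≠ b := fun b hb e => by
    have := hlt b hb
    rw [e] at this
    exact lt_irrefl _ this
  rw [Matrix.det_of_isLowerTriangular]
  · refine Finset.prod_eq_one fun i _ => ?_
    by_cases hi : i = a
    · simp [hi]
    · simp [hi, (hτ i hi).symm]
  · intro i j hij
    have hij' : r i < r j := hij
    have hne : i ≠ j := fun e => by simp [e] at hij'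
    by_cases hi : i = a
    · subst hi
      simp [hne]
    · have : j ≠ τ i := fun e => by
        have := hlt i hi
        rw [← e] at this
        omega
      simp [hi, hne, this]

/-- The cycles of `τ` that avoid `a` survive the deletion of the row of `a`: the indicator of their
union is in the kernel of the matrix. -/
theorem det_one_sub_of_not_sameCycle (τ : Equiv.Perm α) (a b : α) (h : ¬ τ.SameCycle a b) :
    (1 - Matrix.of fun i j => if i = a then (0 : R) else if j = τ i then 1 else 0).det = 0 := by
  classical
  set Q := Matrix.of fun i j => if i = a then (0 : R) else if j = τ i then 1 else 0
  let w : α → R := fun i => if τ.SameCycle a i then 0 else 1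
  have hw : (1 - Q) *ᵥ w = 0 := by
    ext i
    rw [Matrix.sub_mulVec, Matrix.one_mulVec]
    by_cases hi : i = a
    · have h0 : (Q *ᵥ w) i = 0 := by simp [Q, hi, Matrix.mulVec, dotProduct]
      rw [Pi.sub_apply, h0]
      simp [w, hi, Equiv.Perm.SameCycle.refl]
    · have h0 : (Q *ᵥ w) i = w (τ i) := by
        simp only [Q, hi, Matrix.mulVec, dotProduct, Matrix.of_apply, if_false, ite_mul, one_mul,
          zero_mul, Finset.sum_ite_eq', Finset.mem_univ, if_true]
      rw [Pi.sub_apply, h0]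
      simp [w]
  have h2 := congrArg (fun u => ((1 - Q).adjugate *ᵥ u) b) hw
  simpa [Matrix.mulVec_mulVec, Matrix.adjugate_mul, w, h, Matrix.smul_mulVec] using h2

theorem det_one_sub_partialPerm (τ : Equiv.Perm α) (a : α) [Decidable (∀ b, τ.SameCycle a b)] :
    (1 - Matrix.of fun i j => if i = a then (0 : R) else if j = τ i then 1 else 0).det =
      if ∀ b, τ.SameCycle a b then 1 else 0 := by
  split_ifs with h
  · exact det_one_sub_of_sameCycle τ a h
  · push Not at h
    obtain ⟨b, hb⟩ := h
    exact det_one_sub_of_not_sameCycle τ a b hb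

/-- The expansion of the characteristic polynomial by principal minors; the minor with rows and
columns in `S` is written as the determinant of the matrix that agrees with `A` on the rows in `S`
and with the identity matrix on the others. -/
theorem det_sub_smul_one_eq_sum (A : Matrix α α R) (x : R) :
    (A - x • (1 : Matrix α α R)).det = ∑ S : Finset α, (-x) ^ (Fintype.card α - S.card) *
      (1 + Matrix.diagonal (fun i => if i ∈ S then (1 : R) else 0) * (A - 1)).det := by
  have h1 : A - x • (1 : Matrix α α R) = fun i => A i + (-x • (1 : Matrix α α R)) i := by
    ext i j; simp [sub_eq_add_neg]
  change Matrix.detRowAlternating (A - x • (1 : Matrix α α R)) = _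
  rw [h1]
  have h2 := (Matrix.detRowAlternating (n := α) (R := R)).toMultilinearMap.map_add_univ
    A (-x • (1 : Matrix α α R))
  refine h2.trans (Finset.sum_congr rfl fun S _ => ?_)
  change Matrix.det (Matrix.of (S.piecewise A (-x • (1 : Matrix α α R)))) = _
  have h3 : Matrix.of (S.piecewise A (-x • (1 : Matrix α α R))) =
      Matrix.diagonal (fun i => if i ∈ S then (1 : R) else -x) *
      (1 + Matrix.diagonal (fun i => if i ∈ S then (1 : R) else 0) * (A - 1)) := by
    ext i j
    rw [Matrix.diagonal_mul, Matrix.add_apply, Matrix.diagonal_mul]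
    by_cases hi : i ∈ S <;> simp [hi, Finset.piecewise]
  rw [h3, Matrix.det_mul, Matrix.det_diagonal]
  congr 1
  rw [Finset.prod_ite]
  simp [Finset.filter_not, Finset.card_sdiff, Finset.card_univ]

end Determinants

/-! ### Principal minors of the intersection matrix -/

namespace Dessin

section Boundary

variable {V E : Type*}

open Classical in
/-- The exchange of the two ends of the edges in `S`; the ends of the other edges are fixed. -/
def flipOn (S : Set E) : Equiv.Perm (E × Bool) :=
  Equiv.prodCongrRight fun a => if a ∈ S then Equiv.boolNot else 1

theorem flipOn_of_mem {S : Set E} {a : E} (h : a ∈ S) (b : Bool) : flipOn S (a, b) = (a, !b) := by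
  simp [flipOn, h]

theorem flipOn_of_notMem {S : Set E} {a : E} (h : a ∉ S) (b : Bool) :
    flipOn S (a, b) = (a, b) := by
  simp [flipOn, h]

theorem flipOn_flipOn (S : Set E) (h : E × Bool) : flipOn S (flipOn S h) = h := by
  obtain ⟨a, b⟩ := h
  by_cases ha : a ∈ S
  · simp [flipOn_of_mem ha]
  · simp [flipOn_of_notMem ha]

theorem flipOn_inv (S : Set E) : (flipOn S)⁻¹ = flipOn S := by
  rw [inv_eq_iff_mul_eq_one]
  ext1 h
  exact flipOn_flipOn S h

/-- The boundary walk of the sub-dessin with edge set `S` runs through all half-edges of the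
dessin in one cycle: at a half-edge in `S` it crosses over to the other end of the edge, at a
half-edge outside `S` it just continues around the vertex. -/
def Unicursal (D : Dessin V E) (S : Set E) : Prop :=
  ∀ h h', (D.rot * flipOn S).SameCycle h h'

theorem unicursal_iff_sameCycle_flipOn_mul_rot (D : Dessin V E) (S : Set E) :
    D.Unicursal S ↔ ∀ h h', (flipOn S * D.rot).SameCycle h h' := by
  have key : D.rot * flipOn S = D.rot * (flipOn S * D.rot) * D.rot⁻¹ := by group
  unfold Unicursal
  rw [key]
  simp_rw [Equiv.Perm.sameCycle_conj]
  exact ⟨fun H h h' => by simpa using H (D.rot h) (D.rot h'), fun H h h' => H _ _⟩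

theorem unicursal_iff_sameCycle_rot_inv_mul_flipOn (D : Dessin V E) (S : Set E) (a : E × Bool) :
    D.Unicursal S ↔ ∀ h, (D.rot⁻¹ * flipOn S).SameCycle a h := by
  have key : D.rot⁻¹ * flipOn S = (flipOn S * D.rot)⁻¹ := by rw [mul_inv_rev, flipOn_inv]
  rw [unicursal_iff_sameCycle_flipOn_mul_rot, key]
  simp_rw [Equiv.Perm.sameCycle_inv]
  exact ⟨fun H h => H _ _, fun H h h' => (H h).symm.trans (H h')⟩

end Boundary

namespace ChordNumbering

variable {V E : Type*} {D : Dessin V E} (N : D.ChordNumbering)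

theorem lo_chord_lt_iff (i j : Fin (Nat.card E)) :
    N.lo (N.chord i) < N.lo (N.chord j) ↔ i < j :=
  N.chord_strictMono.lt_iff_lt

/-- The orientation of a chord from its second to its first end point: `1` at the first and `-1` at
the second. -/
def endSign (h : E × Bool) : ℤ := if N.point.symm h = N.lo h.1 then 1 else -1

theorem endSign_mul_self (h : E × Bool) : N.endSign h * N.endSign h = 1 := by
  unfold endSign
  split_ifs <;> rfl

theorem endSign_not (a : E) (b : Bool) : N.endSign (a, !b) = -N.endSign (a, b) := by
  have hne : N.point.symm (a, false) ≠ N.point.symm (a, true) := by simp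
  have hne' := hne.symm
  unfold endSign lo
  rcases hne.lt_or_gt with h | h <;> cases b <;>
    simp [min_eq_left h.le, min_eq_right h.le, hne, hne']

/-- The position of `h'` relative to `h`: the strictly lower triangular matrix of ones. -/
def before : Matrix (E × Bool) (E × Bool) ℤ := Matrix.of fun h h' =>
  if N.point.symm h' < N.point.symm h then 1 else 0

open Classical in
/-- The signed incidence matrix of chords and end points. -/
def incidence : Matrix (Fin (Nat.card E)) (E × Bool) ℤ := Matrix.of fun i h =>
  if h.1 = N.chord i then N.endSign h else 0

theorem lo_lt_hi (a : E) : N.lo a < N.hi a := by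
  simp [lo, hi]

theorem point_lo_fst (a : E) : (N.point (N.lo a)).1 = a := by
  unfold lo
  rcases min_choice (N.point.symm (a, false)) (N.point.symm (a, true)) with h | h <;> simp [h]

theorem point_hi_fst (a : E) : (N.point (N.hi a)).1 = a := by
  unfold hi
  rcases max_choice (N.point.symm (a, false)) (N.point.symm (a, true)) with h | h <;> simp [h]

theorem sum_incidence_mul [Fintype E] (i : Fin (Nat.card E)) (g : E × Bool → ℤ) :
    ∑ h, N.incidence i h * g h =
      g (N.point (N.lo (N.chord i))) - g (N.point (N.hi (N.chord i))) := by
  classical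
  have h1 : ∑ h, N.incidence i h * g h =
      N.endSign (N.chord i, true) * g (N.chord i, true) +
        N.endSign (N.chord i, false) * g (N.chord i, false) := by
    simp [incidence, Fintype.sum_prod_type, Finset.sum_add_distrib]
  have hne : N.point.symm (N.chord i, false) ≠ N.point.symm (N.chord i, true) := by simp
  have hne' := hne.symm
  rw [h1]
  unfold endSign lo hi
  rcases hne.lt_or_gt with h | h
  · simp [min_eq_left h.le, max_eq_right h.le]
    ring
  · simp [min_eq_right h.le, max_eq_left h.le]
    ring

/-- The signed intersection number of two oriented chords is read off from the relative positions
of their end points; a chord has intersection number `-1` with itself, hence the summand `1`. -/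
theorem IM_eq [Fintype E] :
    N.IM = 1 + N.incidence * N.before * N.incidence.transpose := by
  classical
  ext i j
  rw [Matrix.add_apply, Matrix.mul_assoc, Matrix.mul_apply, sum_incidence_mul]
  have h1 : ∀ h, (N.before * N.incidence.transpose) h j =
      N.before h (N.point (N.lo (N.chord j))) - N.before h (N.point (N.hi (N.chord j))) := by
    intro h
    rw [← sum_incidence_mul, Matrix.mul_apply]
    exact Finset.sum_congr rfl fun x _ => by rw [Matrix.transpose_apply, mul_comm]
  rw [h1, h1]
  have hi' := N.lo_lt_hi (N.chord i)
  have hj' := N.lo_lt_hi (N.chord j)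
  simp only [before, Matrix.of_apply, Equiv.symm_apply_apply]
  by_cases hij : i = j
  · subst hij
    have hn : ¬ N.Intersect (N.chord i) (N.chord i) := by simp [Intersect]
    simp [IM, hn, hi', hi'.not_gt]
  · have hs := N.lo_chord_lt_iff i j
    have hc : N.chord i ≠ N.chord j := fun e => hij (N.chord.injective e)
    have d2 : N.lo (N.chord i) ≠ N.hi (N.chord j) := fun e => hc (by
      rw [← N.point_lo_fst (N.chord i), e, point_hi_fst])
    have d3 : N.hi (N.chord i) ≠ N.lo (N.chord j) := fun e => hc (by
      rw [← N.point_lo_fst (N.chord j), ← e, point_hi_fst])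
    have d4 : N.hi (N.chord i) ≠ N.hi (N.chord j) := fun e => hc (by
      rw [← N.point_hi_fst (N.chord i), e, point_hi_fst])
    have hsgn : Int.sign ((i : ℤ) - (j : ℤ)) = if i < j then -1 else 1 := by
      rcases lt_or_gt_of_ne hij with h | h
      · rw [if_pos h, Int.sign_eq_neg_one_iff_neg]
        have := Fin.lt_def.mp h
        omega
      · rw [if_neg h.not_gt, Int.sign_eq_one_iff_pos]
        have := Fin.lt_def.mp h
        omega
    have d1 : N.lo (N.chord i) ≠ N.lo (N.chord j) := fun e => hc (by
      rw [← N.point_lo_fst (N.chord i), e, point_lo_fst])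
    simp only [IM, Intersect, Matrix.one_apply_ne hij, hsgn, ← hs]
    generalize N.lo (N.chord i) = p at *
    generalize N.hi (N.chord i) = p' at *
    generalize N.lo (N.chord j) = q at *
    generalize N.hi (N.chord j) = q' at *
    clear hs hsgn h1 hc hij
    grind

theorem val_symm_eq_succ_iff (h h' : E × Bool) :
    (N.point.symm h : ℕ) = N.point.symm h' + 1 ↔
      (N.point.symm h : ℕ) ≠ 0 ∧ h' = D.rot⁻¹ h := by
  have hrot : D.rot h' = N.point (finRotate _ (N.point.symm h')) := by
    rw [← N.rot_point, Equiv.apply_symm_apply]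
  rw [Equiv.Perm.eq_inv_iff_eq, hrot, ← Equiv.eq_symm_apply]
  generalize N.point.symm h = p
  generalize N.point.symm h' = q
  generalize Nat.card (E × Bool) = n at p q
  cases n with
  | zero => exact p.elim0
  | succ n =>
    rw [Fin.ext_iff, coe_finRotate]
    split_ifs with hq
    · subst hq
      have := p.isLt
      simp only [Fin.val_last]
      omega
    · omega


open Classical in
theorem incidence_transpose_mul (S : Finset (Fin (Nat.card E))) (h h' : E × Bool) :
    (N.incidence.transpose *
      (Matrix.diagonal (fun i => if i ∈ S then (1 : ℤ) else 0) * N.incidence)) h h' =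
      (if h' = h then 1 else 0) - if h' = flipOn (N.chord '' S) h then 1 else 0 := by
  obtain ⟨a, b⟩ := h
  obtain ⟨a', b'⟩ := h'
  have hmem : a ∈ N.chord '' (S : Set (Fin (Nat.card E))) ↔ N.chord.symm a ∈ S := by
    constructor
    · rintro ⟨i, hi, rfl⟩
      simpa using hi
    · intro hi
      exact ⟨_, hi, by simp⟩
  have h1 : (N.incidence.transpose *
      (Matrix.diagonal (fun i => if i ∈ S then (1 : ℤ) else 0) * N.incidence)) (a, b) (a', b') =
      if a' = a ∧ N.chord.symm a ∈ S then N.endSign (a, b) * N.endSign (a', b') else 0 := by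
    rw [Matrix.mul_apply, Finset.sum_eq_single (N.chord.symm a)]
    · simp only [Matrix.transpose_apply, incidence, Matrix.of_apply, Matrix.diagonal_mul,
        Equiv.apply_symm_apply, if_true]
      split_ifs <;> simp_all
    · intro i _ hi
      have : a ≠ N.chord i := fun e => hi (by simp [e])
      simp [incidence, this]
    · simp
  rw [h1]
  by_cases ha : N.chord.symm a ∈ S
  · rw [flipOn_of_mem (hmem.mpr ha)]
    by_cases haa : a' = a
    · subst haa
      have e1 := N.endSign_mul_self (a', b)
      have e2 := N.endSign_not a' b
      have hb : b' = b ∨ b' = !b := by cases b <;> cases b' <;> simp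
      rcases hb with rfl | rfl
      · simp [ha, e1]
      · simp [ha, e2, e1]
    · simp [haa]
  · rw [flipOn_of_notMem (fun h => ha (hmem.mp h))]
    simp [ha]

variable [Fintype E]

/-- The shift along the circle, cut at the base point. -/
def shift : Matrix (E × Bool) (E × Bool) ℤ := Matrix.of fun h h' =>
  if (N.point.symm h : ℕ) = N.point.symm h' + 1 then 1 else 0

theorem det_one_sub_shift [DecidableEq E] : (1 - N.shift).det = 1 := by
  let _ : LinearOrder (E × Bool) := LinearOrder.lift' N.point.symm N.point.symm.injective
  rw [Matrix.det_of_isLowerTriangular]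
  · refine Finset.prod_eq_one fun h _ => ?_
    simp [shift]
  · intro h h' hlt
    have hlt' : N.point.symm h < N.point.symm h' := hlt
    have hne : h ≠ h' := fun e => by simp [e] at hlt'
    have h2 : (N.point.symm h : ℕ) ≠ N.point.symm h' + 1 := by
      have := Fin.lt_def.mp hlt'
      omega
    simp [shift, hne, h2]

theorem before_mul_one_sub_shift [DecidableEq E] : N.before * (1 - N.shift) = N.shift := by
  ext h h'
  rw [mul_sub, mul_one, Matrix.sub_apply, Matrix.mul_apply]
  have key : ∑ r, N.before h r * N.shift r h' =
      if (N.point.symm h' + 1 : ℕ) < N.point.symm h then 1 else 0 := by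
    by_cases hl : (N.point.symm h' + 1 : ℕ) < Nat.card (E × Bool)
    · rw [Finset.sum_eq_single (N.point ⟨N.point.symm h' + 1, hl⟩)]
      · simp only [before, shift, Matrix.of_apply, Equiv.symm_apply_apply, Fin.lt_def, if_true,
          mul_one]
      · intro r _ hr
        have : (N.point.symm r : ℕ) ≠ N.point.symm h' + 1 := fun e => hr (by
          rw [← Equiv.symm_apply_eq, Fin.ext_iff, e])
        simp [shift, this]
      · simp
    · rw [if_neg (fun h2 => hl (h2.trans (N.point.symm h).isLt))]
      refine Finset.sum_eq_zero fun r _ => ?_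
      have : (N.point.symm r : ℕ) ≠ N.point.symm h' + 1 := fun e => hl (by
        rw [← e]; exact (N.point.symm r).isLt)
      simp [shift, this]
  rw [key]
  simp only [before, shift, Matrix.of_apply, Fin.lt_def]
  split_ifs <;> first | rfl | omega

open Classical in
/-- The principal minors of the intersection matrix. By Sylvester's identity the minor for `S` is
the determinant of `1 - F * N.shift`, where `F` is the permutation matrix of `flipOn`; and
`F * N.shift` is the permutation matrix of a boundary walk with one row deleted, because the shift
is cut at the base point. -/
theorem minor_eq (S : Finset (Fin (Nat.card E))) :
    (1 + Matrix.diagonal (fun i => if i ∈ S then 1 else 0) * (N.IM - 1)).det =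
      if D.Unicursal (N.chord '' S) then 1 else 0 := by
  rcases isEmpty_or_nonempty E with hE | hE
  · have : IsEmpty (Fin (Nat.card E)) := N.chord.isEmpty
    rw [Matrix.det_isEmpty, if_pos]
    exact fun h => isEmptyElim h
  set F : Matrix (E × Bool) (E × Bool) ℤ :=
    Matrix.of fun h h' => if h' = flipOn (N.chord '' S) h then 1 else 0 with hF
  set Δ : Matrix (Fin (Nat.card E)) (Fin (Nat.card E)) ℤ :=
    Matrix.diagonal (fun i => if i ∈ S then 1 else 0) with hΔ
  have h1 : N.incidence.transpose * (Δ * N.incidence) = 1 - F := by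
    ext h h'
    rw [hΔ, incidence_transpose_mul, Matrix.sub_apply, Matrix.one_apply]
    simp [hF, eq_comm]
  have h2 : Δ * (N.IM - 1) = (Δ * N.incidence * N.before) * N.incidence.transpose := by
    rw [IM_eq, add_sub_cancel_left]
    simp only [Matrix.mul_assoc]
  have h3 : (1 + Δ * (N.IM - 1)).det = (1 + (1 - F) * N.before).det := by
    rw [h2, Matrix.det_one_add_mul_comm, ← h1]
    simp only [Matrix.mul_assoc]
  have h4 : (1 + (1 - F) * N.before) * (1 - N.shift) = 1 - F * N.shift := by
    rw [add_mul, one_mul, mul_assoc, before_mul_one_sub_shift, sub_mul, one_mul]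
    abel
  have hpos : 0 < Nat.card (E × Bool) := Nat.card_pos
  set a : E × Bool := flipOn (N.chord '' S) (N.point ⟨0, hpos⟩) with ha
  have h5 : F * N.shift = Matrix.of fun h h' => if h = a then (0 : ℤ) else
      if h' = (D.rot⁻¹ * flipOn (N.chord '' S)) h then 1 else 0 := by
    ext h h'
    have h6 : (F * N.shift) h h' = N.shift (flipOn (N.chord '' S) h) h' := by
      simp [Matrix.mul_apply, hF]
    have h7 : h = a ↔ (N.point.symm (flipOn (N.chord '' S) h) : ℕ) = 0 := by
      have : (N.point.symm (flipOn (N.chord '' S) h) : ℕ) = 0 ↔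
          N.point.symm (flipOn (N.chord '' S) h) = ⟨0, hpos⟩ := by rw [Fin.ext_iff]
      rw [this, Equiv.symm_apply_eq]
      constructor
      · rintro rfl
        rw [ha, flipOn_flipOn]
      · intro e
        rw [ha, ← e, flipOn_flipOn]
    rw [h6]
    simp only [shift, Matrix.of_apply, val_symm_eq_succ_iff, h7, Equiv.Perm.mul_apply]
    split_ifs <;> simp_all
  have h8 : (1 + Δ * (N.IM - 1)).det = (1 - F * N.shift).det := by
    rw [h3, ← mul_one (Matrix.det _), ← N.det_one_sub_shift, ← Matrix.det_mul, h4]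
  rw [h8, h5, det_one_sub_partialPerm]
  simp only [unicursal_iff_sameCycle_rot_inv_mul_flipOn D _ a]

open Classical in
/-- The characteristic polynomial of the intersection matrix, with coefficients in any ring, as a
sum over the unicursal sets of edges. -/
theorem det_IM_sub_smul_one {R : Type*} [CommRing R] (x : R) :
    (N.IM.map (Int.cast : ℤ → R) - x • (1 : Matrix _ _ R)).det =
      ∑ S : Finset E, if D.Unicursal S then (-x) ^ (Nat.card E - S.card) else 0 := by
  rw [det_sub_smul_one_eq_sum, Fintype.card_fin,
    ← (Equiv.finsetCongr N.chord).sum_comp]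
  refine Finset.sum_congr rfl fun S _ => ?_
  have h1 : (1 + Matrix.diagonal (fun i => if i ∈ S then (1 : R) else 0) *
      (N.IM.map (Int.cast : ℤ → R) - 1)) =
      (Int.castRingHom R).mapMatrix
        (1 + Matrix.diagonal (fun i => if i ∈ S then 1 else 0) * (N.IM - 1)) := by
    ext i j
    simp [Matrix.diagonal_mul, Matrix.one_apply, apply_ite (Int.cast : ℤ → R)]
  rw [h1, ← RingHom.map_det, minor_eq]
  simp

end ChordNumbering
end Dessin

/-! ### Quasi-trees and boundary walks -/

section FirstReturnCongr

variable {α β : Type*} {σ ψ : Equiv.Perm α}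

theorem pow_apply_eq_of_eq_off {T : Set α} (h : ∀ x ∉ T, ψ x = σ x) (n : ℕ) (x : α)
    (hx : ∀ j < n, (σ ^ j) x ∉ T) : (ψ ^ n) x = (σ ^ n) x := by
  induction n with
  | zero => rfl
  | succ n ih =>
    rw [pow_succ', pow_succ', Equiv.Perm.mul_apply, Equiv.Perm.mul_apply,
      ih fun j hj => hx j (by omega), h _ (hx n (by omega))]

variable [Finite α] {ι : β ↪ α} {b c : β}

theorem pow_returnTime_eq_of_eq_off (h : ∀ x ∉ Set.range ι, ψ x = σ x) (hbc : ψ (ι b) = σ (ι c)) :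
    (ψ ^ returnTime σ ι c) (ι b) = ι (returnPoint σ ι c) := by
  rw [← pow_returnTime]
  obtain ⟨k, hk⟩ := Nat.exists_eq_succ_of_ne_zero (returnTime_pos σ ι c).ne'
  rw [hk, pow_succ, pow_succ, Equiv.Perm.mul_apply, Equiv.Perm.mul_apply, hbc]
  refine pow_apply_eq_of_eq_off h k _ fun j hj => ?_
  rintro ⟨d, hd⟩
  have := returnTime_le (σ := σ) (ι := ι) (b := c) (c := d) (n := j + 1) (by omega)
    (by rw [pow_succ, Equiv.Perm.mul_apply, hd])
  omega

theorem returnTime_le_of_eq_off (h : ∀ x ∉ Set.range ι, ψ x = σ x) (hbc : ψ (ι b) = σ (ι c)) :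
    returnTime ψ ι b ≤ returnTime σ ι c :=
  returnTime_le ψ ι (returnTime_pos σ ι c) (pow_returnTime_eq_of_eq_off h hbc)

/-- Two permutations that agree outside a subset and send two points of it to the same point have
the same first return from there on. -/
theorem firstReturn_eq_of_eq_off (h : ∀ x ∉ Set.range ι, ψ x = σ x) (hbc : ψ (ι b) = σ (ι c)) :
    firstReturn ψ ι b = firstReturn σ ι c := by
  have h1 : returnTime ψ ι b = returnTime σ ι c :=
    le_antisymm (returnTime_le_of_eq_off h hbc)
      (returnTime_le_of_eq_off (fun x hx => (h x hx).symm) hbc.symm)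
  apply ι.injective
  rw [firstReturn_apply, firstReturn_apply, ← pow_returnTime, h1, pow_returnTime_eq_of_eq_off h hbc]

end FirstReturnCongr

theorem sign_of_forall_sameCycle {α : Type*} [Fintype α] [DecidableEq α] [Nontrivial α]
    {σ : Equiv.Perm α} (h : ∀ x y, σ.SameCycle x y) :
    Equiv.Perm.sign σ = -(-1) ^ Fintype.card α := by
  have hne : ∀ x, σ x ≠ x := by
    intro x hx
    obtain ⟨y, hy⟩ := exists_ne x
    exact hy ((h x y).eq_of_left hx).symm
  obtain ⟨x⟩ : Nonempty α := inferInstance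
  have hc : σ.IsCycle := ⟨x, hne x, fun y _ => h x y⟩
  rw [hc.sign]
  congr 2
  rw [← Finset.card_univ]
  congr 1
  ext y
  simp [hne]

namespace Dessin

variable {V E : Type*} (D : Dessin V E)

theorem sameCycle_rot_of_v_eq_one (hv : D.v = 1) (h h' : E × Bool) : D.rot.SameCycle h h' := by
  have := (Nat.card_eq_one_iff_unique.mp hv).1
  exact (D.sameCycle_iff h h').mpr (Subsingleton.elim _ _)

theorem unicursal_empty (hv : D.v = 1) : D.Unicursal (∅ : Set E) := by
  have : flipOn (∅ : Set E) = 1 := by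
    ext1 ⟨a, b⟩
    exact flipOn_of_notMem (by simp) b
  intro h h'
  rw [this, mul_one]
  exact D.sameCycle_rot_of_v_eq_one hv h h'

theorem rot_mul_flipOn_of_notMem_range {S : Set E} (h : E × Bool)
    (hh : h ∉ Set.range (halfEdgeEmb S)) : (D.rot * flipOn S) h = D.rot h := by
  obtain ⟨a, b⟩ := h
  rw [Equiv.Perm.mul_apply, flipOn_of_notMem]
  exact fun ha => hh ⟨(⟨a, ha⟩, b), rfl⟩

variable [Finite E]

theorem faceRot_sub (S : Set E) :
    (D.sub S).faceRot = firstReturn (D.rot * flipOn S) (halfEdgeEmb S) := by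
  ext1 ⟨⟨a, ha⟩, b⟩
  refine (firstReturn_eq_of_eq_off (D.rot_mul_flipOn_of_notMem_range) ?_).symm
  exact congrArg D.rot (flipOn_of_mem ha b)

theorem exists_sameCycle_halfEdgeEmb (hv : D.v = 1) {S : Set E} (hS : S.Nonempty) (h : E × Bool) :
    ∃ k, (D.rot * flipOn S).SameCycle h (halfEdgeEmb S k) := by
  classical
  have := Fintype.ofFinite E
  obtain ⟨a, ha⟩ := hS
  have hex : ∃ n : ℕ, (D.rot ^ n) h ∈ Set.range (halfEdgeEmb S) := by
    obtain ⟨n, -, -, hn⟩ := (D.sameCycle_rot_of_v_eq_one hv h (a, false)).exists_pow_eq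
    exact ⟨n, (⟨a, ha⟩, false), hn.symm⟩
  obtain ⟨k, hk⟩ := Nat.find_spec hex
  refine ⟨k, (Nat.find hex : ℕ), ?_⟩
  rw [zpow_natCast, hk]
  exact pow_apply_eq_of_eq_off D.rot_mul_flipOn_of_notMem_range _ _ fun j hj => Nat.find_min hex hj

/-- The faces of a spanning sub-dessin are the boundary walks; a vertex that loses all its
half-edges is counted as a face in `Dessin.f`, and is a boundary walk that crosses no edge. -/
theorem f_sub_eq_one_iff (hv : D.v = 1) (S : Set E) : (D.sub S).f = 1 ↔ D.Unicursal S := by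
  obtain ⟨hV, hV'⟩ := Nat.card_eq_one_iff_unique.mp hv
  unfold f
  rcases S.eq_empty_or_nonempty with rfl | hS
  · refine iff_of_true ?_ (D.unicursal_empty hv)
    have h1 : IsEmpty (Quotient (Equiv.Perm.SameCycle.setoid (D.sub (∅ : Set E)).faceRot)) :=
      ⟨fun q => q.inductionOn fun h => h.1.2⟩
    have h2 : Nat.card {x : V // ∀ h, (D.sub (∅ : Set E)).vert h ≠ x} = 1 := by
      rw [Nat.card_congr (Equiv.subtypeUnivEquiv fun x h => absurd h.1.2 (Set.notMem_empty _))]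
      exact hv
    rw [h2, Nat.card_of_isEmpty]
  · obtain ⟨a, ha⟩ := id hS
    have h1 : IsEmpty {x : V // ∀ h, (D.sub S).vert h ≠ x} :=
      ⟨fun x => x.2 (⟨a, ha⟩, false) (Subsingleton.elim _ _)⟩
    rw [Nat.card_of_isEmpty (α := {x : V // ∀ h, (D.sub S).vert h ≠ x}), add_zero,
      Nat.card_eq_one_iff_unique, faceRot_sub]
    constructor
    · rintro ⟨hs, -⟩ h h'
      obtain ⟨k, hk⟩ := D.exists_sameCycle_halfEdgeEmb hv hS h
      obtain ⟨k', hk'⟩ := D.exists_sameCycle_halfEdgeEmb hv hS h'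
      have h2 := Quotient.exact (hs.elim (Quotient.mk _ k) (Quotient.mk _ k'))
      exact hk.trans (((sameCycle_firstReturn _ _ _ _).mp h2).trans hk'.symm)
    · intro hU
      refine ⟨⟨fun q q' => ?_⟩, ⟨Quotient.mk _ (⟨a, ha⟩, false)⟩⟩
      induction q using Quotient.inductionOn with | _ k =>
      induction q' using Quotient.inductionOn with | _ k' =>
      exact Quotient.sound ((sameCycle_firstReturn _ _ _ _).mpr (hU _ _))

theorem isQuasiTree_sub_iff (hv : D.v = 1) (S : Set E) (j : ℕ) :
    (D.sub S).IsQuasiTree j ↔ S.ncard = 2 * j ∧ D.Unicursal S := by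
  obtain ⟨hV, hV'⟩ := Nat.card_eq_one_iff_unique.mp hv
  have hk : (D.sub S).k = 1 := by
    unfold k
    rw [Nat.card_eq_one_iff_unique]
    refine ⟨⟨fun x y => ?_⟩, hV'.map (Quot.mk _)⟩
    induction x using Quot.inductionOn with | _ x =>
    induction y using Quot.inductionOn with | _ y =>
    rw [Subsingleton.elim x y]
  have hv' : (D.sub S).v = 1 := hv
  have he : (D.sub S).e = S.ncard := rfl
  unfold IsQuasiTree genus
  rw [hk, hv', he, ← D.f_sub_eq_one_iff hv]
  constructor
  · rintro ⟨-, -, hf, h⟩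
    exact ⟨by omega, hf⟩
  · rintro ⟨h, hf⟩
    rw [hf]
    refine ⟨rfl, ?_, rfl, ?_⟩ <;> omega

theorem sign_flipOn {E : Type*} [Fintype E] [DecidableEq E] (S : Finset E) :
    Equiv.Perm.sign (flipOn (S : Set E)) = (-1) ^ S.card := by
  have h1 : Equiv.Perm.sign Equiv.boolNot = -1 := by decide
  rw [flipOn, Equiv.Perm.sign_prodCongrRight]
  simp [apply_ite Equiv.Perm.sign, h1]

/-- The rotation and the boundary walk are both cyclic permutations of all half-edges, so they have
the same sign. -/
theorem Unicursal.even_card {E : Type*} [Fintype E] {D : Dessin V E} (hv : D.v = 1) {S : Finset E}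
    (h : D.Unicursal S) : Even S.card := by
  classical
  rcases isEmpty_or_nonempty E with hE | hE
  · simp [Finset.eq_empty_of_isEmpty S]
  · have h1 := sign_of_forall_sameCycle h
    rw [Equiv.Perm.sign_mul, sign_of_forall_sameCycle (D.sameCycle_rot_of_v_eq_one hv),
      sign_flipOn] at h1
    have h2 : ((-1 : ℤˣ)) ^ S.card = 1 := by simpa using h1
    rcases Nat.even_or_odd S.card with h3 | h3
    · exact h3
    · rw [h3.neg_one_pow] at h2
      exact absurd h2 (by decide)

open Classical in
theorem s_eq_card {E : Type*} [Fintype E] {D : Dessin V E} (hv : D.v = 1) (j : ℕ) :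
    D.s j = (Finset.univ.filter fun S : Finset E => D.Unicursal S ∧ S.card = 2 * j).card := by
  unfold s
  rw [← Set.ncard_coe_finset, ← Set.ncard_image_of_injective _ Finset.coe_injective]
  congr 1
  ext S
  simp only [Set.mem_ofPred_eq, D.isQuasiTree_sub_iff hv, Set.mem_image, Finset.mem_coe,
    Finset.mem_filter, Finset.mem_univ, true_and]
  constructor
  · rintro ⟨h1, h2⟩
    refine ⟨S.toFinset, ⟨by simpa using h2, ?_⟩, by simp⟩
    rw [← h1, Set.ncard_eq_toFinset_card']
  · rintro ⟨T, ⟨h1, h2⟩, rfl⟩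
    exact ⟨by rw [Set.ncard_coe_finset, h2], h1⟩

open Classical in
theorem sum_unicursal_eq_sum_s {E R : Type*} [Fintype E] [CommRing R] {D : Dessin V E}
    (hv : D.v = 1) (x : R) :
    (∑ S : Finset E, if D.Unicursal S then (-x) ^ (Nat.card E - S.card) else 0) =
      (-1) ^ D.e * ∑ j ∈ Finset.range (D.e / 2 + 1), (D.s j : R) * x ^ (D.e - 2 * j) := by
  have hcard : ∀ S : Finset E, S.card ≤ Nat.card E := fun S => by
    rw [Nat.card_eq_fintype_card]
    exact S.card_le_univ
  have he : D.e = Nat.card E := rfl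
  rw [← Finset.sum_filter, Finset.mul_sum, he,
    ← Finset.sum_fiberwise_of_maps_to (t := Finset.range (Nat.card E / 2 + 1))
      (g := fun S : Finset E => S.card / 2)]
  · refine Finset.sum_congr rfl fun j _ => ?_
    rw [s_eq_card hv, ← nsmul_eq_mul, ← Finset.sum_const, Finset.mul_sum, Finset.filter_filter]
    refine Finset.sum_congr ?_ ?_
    · ext S
      simp only [Finset.mem_filter, Finset.mem_univ, true_and]
      refine and_congr_right fun hU => ?_
      obtain ⟨r, hr⟩ := hU.even_card hv
      omega
    · intro S hS
      simp only [Finset.mem_filter, Finset.mem_univ, true_and] at hS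
      have := hcard S
      have h1 : Nat.card E = (Nat.card E - 2 * j) + 2 * j := by omega
      rw [hS.2, neg_pow]
      congr 1
      conv_rhs => rw [h1, pow_add, pow_mul]
      simp
  · intro S _
    have := hcard S
    simp only [Finset.mem_range]
    omega

theorem det_IM_sub_X {D : Dessin V E} (hv : D.v = 1) (N : D.ChordNumbering) :
    (N.IM.map Polynomial.C - (Polynomial.X : ℤ[X]) • (1 : Matrix _ _ ℤ[X])).det =
      (-1) ^ D.e * ∑ j ∈ Finset.range (D.e / 2 + 1),
        (D.s j : ℤ[X]) * Polynomial.X ^ (D.e - 2 * j) := by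
  have := Fintype.ofFinite E
  have hC : (Polynomial.C : ℤ → ℤ[X]) = Int.cast := funext fun n => eq_intCast Polynomial.C n
  rw [hC, N.det_IM_sub_smul_one, sum_unicursal_eq_sum_s hv]

end Dessin

/-! ### Checkerboard colourings of planar maps -/

section PlanarMaps

open Module

variable {α : Type*}

/-- The functions with values in `ZMod 2` that are constant on the cycles of a permutation. -/
def invariants (σ : Equiv.Perm α) : Submodule (ZMod 2) (α → ZMod 2) :=
  LinearMap.ker (LinearMap.funLeft (ZMod 2) (ZMod 2) σ - LinearMap.id)

theorem mem_invariants {σ : Equiv.Perm α} {g : α → ZMod 2} :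
    g ∈ invariants σ ↔ ∀ d, g (σ d) = g d := by
  simp only [invariants, LinearMap.mem_ker, LinearMap.sub_apply, LinearMap.id_apply, sub_eq_zero]
  exact funext_iff

theorem eq_of_sameCycle_of_mem_invariants {σ : Equiv.Perm α} {g : α → ZMod 2}
    (hg : g ∈ invariants σ) {a b : α} (h : σ.SameCycle a b) : g a = g b := by
  rw [mem_invariants] at hg
  obtain ⟨n, rfl⟩ := h
  induction n with
  | zero => rfl
  | succ n ih => rw [add_comm, zpow_one_add, Equiv.Perm.mul_apply, hg, ih]
  | pred n ih =>
    rw [ih, ← hg ((σ ^ (-(n : ℤ) - 1)) a), ← Equiv.Perm.mul_apply, ← zpow_one_add,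
      add_sub_cancel]

/-- The sum of the values of a function at the two ends of every edge, for a map with edge
involution `π`. On a function that is constant on the faces this is the coboundary: the values on
the two sides of the edge are added. -/
def edgeSum (π : Equiv.Perm α) : (α → ZMod 2) →ₗ[ZMod 2] (α → ZMod 2) :=
  LinearMap.funLeft (ZMod 2) (ZMod 2) π + LinearMap.id

theorem edgeSum_apply (π : Equiv.Perm α) (g : α → ZMod 2) (d : α) :
    edgeSum π g d = g (π d) + g d := rfl

theorem ker_edgeSum (π : Equiv.Perm α) : LinearMap.ker (edgeSum π) = invariants π := by
  ext g
  rw [LinearMap.mem_ker, mem_invariants, funext_iff]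
  refine forall_congr' fun d => ?_
  rw [edgeSum_apply, Pi.zero_apply, CharTwo.add_eq_zero]

variable [Finite α]

/-- The functions that factor through a surjection form a space whose dimension is the number of
its fibres. -/
theorem finrank_eq_card_of_factors {β : Type*} {p : Submodule (ZMod 2) (α → ZMod 2)} (q : α → β)
    (hq : Function.Surjective q) (h : ∀ g, g ∈ p ↔ ∃ f : β → ZMod 2, f ∘ q = g) :
    finrank (ZMod 2) p = Nat.card β := by
  have : Finite β := Finite.of_surjective q hq
  have := Fintype.ofFinite β
  have hp : p = LinearMap.range (LinearMap.funLeft (ZMod 2) (ZMod 2) q) := by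
    ext g
    rw [h]
    rfl
  rw [hp, LinearMap.finrank_range_of_inj (LinearMap.funLeft_injective_of_surjective _ _ q hq),
    Module.finrank_fintype_fun_eq_card, Nat.card_eq_fintype_card]

theorem finrank_invariants (σ : Equiv.Perm α) :
    finrank (ZMod 2) (invariants σ) = Nat.card (Quotient (Equiv.Perm.SameCycle.setoid σ)) := by
  refine finrank_eq_card_of_factors (Quotient.mk _) Quotient.mk_surjective fun g => ?_
  constructor
  · intro hg
    exact ⟨Quotient.lift g fun a b h => eq_of_sameCycle_of_mem_invariants hg h, rfl⟩
  · rintro ⟨f, rfl⟩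
    rw [mem_invariants]
    intro d
    exact congrArg f (Quotient.sound (Equiv.Perm.sameCycle_apply_left.mpr
      (Equiv.Perm.SameCycle.refl _ _)))

theorem finrank_map_add_finrank_inf_ker {W : Type*} [AddCommGroup W] [Module (ZMod 2) W]
    [FiniteDimensional (ZMod 2) W] (L : W →ₗ[ZMod 2] W) (p : Submodule (ZMod 2) W) :
    finrank (ZMod 2) (p.map L) + finrank (ZMod 2) (p ⊓ LinearMap.ker L : Submodule (ZMod 2) W) =
      finrank (ZMod 2) p := by
  rw [← LinearMap.finrank_range_add_finrank_ker (L.domRestrict p), LinearMap.range_domRestrict,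
    LinearMap.ker_domRestrict, ← Submodule.map_comap_subtype, Submodule.finrank_map_subtype_eq]

theorem card_le_two_mul_finrank_invariants {π : Equiv.Perm α} (hπ : ∀ d, π (π d) = d) :
    Nat.card α ≤ 2 * finrank (ZMod 2) (invariants π) := by
  have := Fintype.ofFinite α
  have h1 := LinearMap.finrank_range_add_finrank_ker (edgeSum π)
  have h2 : LinearMap.range (edgeSum π) ≤ invariants π := by
    rintro _ ⟨g, rfl⟩
    rw [mem_invariants]
    intro d
    rw [edgeSum_apply, edgeSum_apply, hπ, add_comm]
  have h3 := Submodule.finrank_mono h2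
  rw [ker_edgeSum, Module.finrank_fintype_fun_eq_card] at h1
  rw [Nat.card_eq_fintype_card]
  omega

/-- The first cohomology with coefficients in `ZMod 2` of a planar map: a function on the edges
with even sum around every vertex is the coboundary of a function on the faces. The map is given by
the rotation `ρ` around the vertices and the edge involution `π`; its faces are the cycles of
`ρ * π`, and `hplanar` is Euler's formula. The coboundaries are orthogonal to the functions on the
edges and to the functions on the vertices, and by Euler's formula nothing else is missing. -/
theorem exists_edgeSum_eq [Fintype α] {ρ π : Equiv.Perm α} (hπ : ∀ d, π (π d) = d)
    (hπ' : ∀ d, π d ≠ d)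
    (hplanar : 2 * finrank (ZMod 2) (invariants ρ) + 2 * finrank (ZMod 2) (invariants (ρ * π)) =
      Nat.card α +
        4 * finrank (ZMod 2) (invariants π ⊓ invariants ρ : Submodule (ZMod 2) (α → ZMod 2)))
    {w : α → ZMod 2} (hw : w ∈ invariants π) (hw' : ∀ h ∈ invariants ρ, ∑ d, h d * w d = 0) :
    ∃ g ∈ invariants (ρ * π), edgeSum π g = w := by
  classical
  let B : LinearMap.BilinForm (ZMod 2) (α → ZMod 2) := Matrix.toBilin' (1 : Matrix α α (ZMod 2))
  have hBapp : ∀ x y, B x y = ∑ d, x d * y d := by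
    intro x y
    simp [B, Matrix.toBilin'_apply', dotProduct]
  have hB : B.Nondegenerate := (Matrix.nondegenerate_of_det_ne_zero (by simp)).toBilin'
  -- functions on the edges are orthogonal to each other, as every edge has two ends
  have hpair : ∀ x ∈ invariants π, ∀ y ∈ invariants π, ∑ d, x d * y d = 0 := by
    intro x hx y hy
    rw [mem_invariants] at hx hy
    refine Finset.sum_involution (fun d _ => π d) ?_ ?_ ?_ ?_
    · intro d _
      rw [hx, hy, CharTwo.add_self_eq_zero]
    · intro d _ _
      exact hπ' d
    · simp
    · intro d _
      exact hπ d
  have hK : ∀ u, u ∈ B.orthogonal (invariants π ⊔ invariants ρ) ↔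
      (∀ h ∈ invariants π, ∑ d, h d * u d = 0) ∧ ∀ h ∈ invariants ρ, ∑ d, h d * u d = 0 := by
    intro u
    simp only [LinearMap.BilinForm.mem_orthogonal_iff]
    constructor
    · intro H
      exact ⟨fun h hh => by rw [← hBapp]; exact H h (Submodule.mem_sup_left hh),
        fun h hh => by rw [← hBapp]; exact H h (Submodule.mem_sup_right hh)⟩
    · rintro ⟨H1, H2⟩ h hh
      obtain ⟨x, hx, y, hy, rfl⟩ := Submodule.mem_sup.mp hh
      rw [map_add, LinearMap.add_apply, hBapp, hBapp, H1 x hx, H2 y hy, add_zero]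
  have hle : (invariants (ρ * π)).map (edgeSum π) ≤
      B.orthogonal (invariants π ⊔ invariants ρ) := by
    rintro _ ⟨g, hg, rfl⟩
    rw [SetLike.mem_coe, mem_invariants] at hg
    have hg' : ∀ d, g (π d) = g (ρ d) := fun d => by
      have := hg (π d)
      rw [Equiv.Perm.mul_apply, hπ] at this
      exact this.symm
    rw [hK]
    constructor
    · intro h hh
      rw [mem_invariants] at hh
      simp only [edgeSum_apply, mul_add, Finset.sum_add_distrib]
      rw [← Equiv.sum_comp π fun d => h d * g d]
      simp only [hh, CharTwo.add_self_eq_zero]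
    · intro h hh
      rw [mem_invariants] at hh
      simp only [edgeSum_apply, mul_add, Finset.sum_add_distrib]
      rw [← Equiv.sum_comp ρ fun d => h d * g d]
      simp only [hh, hg', CharTwo.add_self_eq_zero]
  have hinf : invariants (ρ * π) ⊓ LinearMap.ker (edgeSum π) = invariants π ⊓ invariants ρ := by
    rw [ker_edgeSum]
    ext g
    simp only [Submodule.mem_inf, mem_invariants, Equiv.Perm.mul_apply]
    constructor
    · rintro ⟨h1, h2⟩
      refine ⟨h2, fun d => ?_⟩
      have := h1 (π d)
      rwa [hπ, h2] at this
    · rintro ⟨h1, h2⟩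
      exact ⟨fun d => by rw [h2, h1], h1⟩
  have hdim : finrank (ZMod 2) (B.orthogonal (invariants π ⊔ invariants ρ)) ≤
      finrank (ZMod 2) ((invariants (ρ * π)).map (edgeSum π)) := by
    have e1 := finrank_map_add_finrank_inf_ker (edgeSum π) (invariants (ρ * π))
    have e2 := LinearMap.BilinForm.finrank_orthogonal hB (invariants π ⊔ invariants ρ)
    have e3 := Submodule.finrank_sup_add_finrank_inf_eq (invariants π) (invariants ρ)
    have e4 := card_le_two_mul_finrank_invariants hπ
    rw [hinf] at e1
    rw [Module.finrank_fintype_fun_eq_card, ← Nat.card_eq_fintype_card] at e2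
    omega
  have hmem : w ∈ B.orthogonal (invariants π ⊔ invariants ρ) :=
    (hK w).mpr ⟨fun h hh => hpair h hh w hw, hw'⟩
  rw [← Submodule.eq_of_le_of_finrank_le hle hdim] at hmem
  exact hmem

end PlanarMaps

namespace LinkDiagram

variable {C : Type*}

/-- The rotation of the four ends around every crossing. -/
def rotation (C : Type*) : Equiv.Perm (C × ZMod 4) :=
  Equiv.prodCongr (Equiv.refl C) (Equiv.addRight (1 : ZMod 4))

theorem rotation_apply (c : C) (i : ZMod 4) : rotation C (c, i) = (c, i + 1) := rfl

theorem eq_of_mem_invariants_rotation {g : C × ZMod 4 → ZMod 2} (hg : g ∈ invariants (rotation C))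
    (c : C) (i : ZMod 4) : g (c, i) = g (c, 0) := by
  rw [mem_invariants] at hg
  have h0 := hg (c, 0)
  have h1 := hg (c, 1)
  have h2 := hg (c, 2)
  simp only [rotation_apply] at h0 h1 h2
  have hi : i = 0 ∨ i = 0 + 1 ∨ i = 1 + 1 ∨ i = 2 + 1 := by
    revert i
    decide
  rcases hi with rfl | rfl | rfl | rfl
  · rfl
  · exact h0
  · exact h1.trans h0
  · exact h2.trans (h1.trans h0)

theorem finrank_invariants_rotation [Finite C] :
    Module.finrank (ZMod 2) (invariants (rotation C)) = Nat.card C := by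
  refine finrank_eq_card_of_factors Prod.fst Prod.fst_surjective fun g => ⟨fun hg => ?_, ?_⟩
  · exact ⟨fun c => g (c, 0), funext fun d => (eq_of_mem_invariants_rotation hg d.1 d.2).symm⟩
  · rintro ⟨f, rfl⟩
    rw [mem_invariants]
    intro d
    rfl

variable (P : LinkDiagram C)

theorem finrank_invariants_pair_inf_rotation [Finite C] :
    Module.finrank (ZMod 2)
        (invariants P.pair ⊓ invariants (rotation C) : Submodule (ZMod 2) (C × ZMod 4 → ZMod 2)) =
      Nat.card (Quot fun c c' : C => ∃ i i', P.pair (c, i) = (c', i')) := by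
  refine finrank_eq_card_of_factors (fun d => Quot.mk _ d.1)
    (Quot.mk_surjective.comp Prod.fst_surjective) fun g => ⟨fun hg => ?_, ?_⟩
  · obtain ⟨h1, h2⟩ := Submodule.mem_inf.mp hg
    refine ⟨Quot.lift (fun c => g (c, 0)) ?_,
      funext fun d => (eq_of_mem_invariants_rotation h2 d.1 d.2).symm⟩
    rintro c c' ⟨i, i', hii⟩
    have := mem_invariants.mp h1 (c, i)
    rw [hii, eq_of_mem_invariants_rotation h2, eq_of_mem_invariants_rotation h2 c i] at this
    exact this.symm
  · rintro ⟨f, rfl⟩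
    rw [Submodule.mem_inf, mem_invariants, mem_invariants]
    refine ⟨fun d => congrArg f ?_, fun d => rfl⟩
    exact (Quot.sound ⟨d.2, (P.pair d).2, rfl⟩).symm

/-- The checkerboard colouring of the faces of a link diagram, as a function on the ends: the two
sides of an arc of the projection have different colours, and so have neighbouring corners at a
crossing. -/
theorem exists_checkerboard [Finite C] : ∃ o : C × ZMod 4 → ZMod 2,
    (∀ d, o (P.pair d) = o d + 1) ∧ ∀ c i, o (c, i + 1) = o (c, i) + 1 := by
  have := Fintype.ofFinite C
  have hplanar := P.planar
  change Nat.card (Quotient (Equiv.Perm.SameCycle.setoid (rotation C * P.pair))) = _ at hplanar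
  rw [← finrank_invariants, ← finrank_invariants_pair_inf_rotation] at hplanar
  have hcard : Nat.card (C × ZMod 4) = 4 * Nat.card C := by
    rw [Nat.card_prod, Nat.card_zmod, mul_comm]
  obtain ⟨g, hg, hgw⟩ := exists_edgeSum_eq (ρ := rotation C) P.pair_pair P.pair_ne
    (by rw [finrank_invariants_rotation]; omega) (w := fun _ => 1)
    (by rw [mem_invariants]; exact fun _ => rfl) (by
      intro h hh
      rw [Fintype.sum_prod_type]
      refine Finset.sum_eq_zero fun c _ => ?_
      simp only [eq_of_mem_invariants_rotation hh c, mul_one, Finset.sum_const, Finset.card_univ,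
        ZMod.card]
      have h4 : ∀ x : ZMod 2, 4 • x = 0 := by decide
      exact h4 _)
  have h1 : ∀ d, g (P.pair d) = g d + 1 := by
    intro d
    have h2 := congrFun hgw d
    rw [edgeSum_apply] at h2
    have h3 : ∀ x y : ZMod 2, x + y = 1 → x = y + 1 := by decide
    exact h3 _ _ h2
  refine ⟨g, h1, fun c i => ?_⟩
  rw [mem_invariants] at hg
  have h2 := hg (P.pair (c, i))
  rw [Equiv.Perm.mul_apply, P.pair_pair, rotation_apply, h1] at h2
  exact h2

end LinkDiagram

/-! ### State circles and boundary walks -/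

namespace LinkDiagram

variable {C : Type*} {P : LinkDiagram C}

/-- When the all-`A` state is a single circle, its direction alternates between outgoing and
incoming around every crossing: it agrees, up to a global change of sign, with the checkerboard
colouring. This is the only use of planarity. -/
theorem CircleOrientation.out_add_one [Finite C] (O : P.CircleOrientation)
    [Subsingleton (P.Circle (allA C))] (c : C) (i : ZMod 4) :
    O.out (c, i + 1) = !O.out (c, i) := by
  obtain ⟨o, ho, ho'⟩ := P.exists_checkerboard
  have hflip : ∀ x y : ZMod 2, x = y + 1 → decide (x = 1) = !decide (y = 1) := by decide
  have hsplice : ∀ c i, o (c, 1 - i) = o (c, i) + 1 := by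
    intro c i
    have hi : (i = 0 ∨ i = 2) ∨ ((1 - i) = 0 ∨ (1 - i) = 2) := by
      revert i
      decide
    have e : ∀ i : ZMod 4, i = 0 ∨ i = 2 → 1 - i = i + 1 := by decide
    have e2 : ∀ x y : ZMod 2, x = y + 1 → y = x + 1 := by decide
    rcases hi with h | h
    · rw [e i h, ho']
    · have h2 := ho' c (1 - i)
      rw [← e _ h, sub_sub_cancel] at h2
      exact e2 _ _ h2
  let q : P.Circle (allA C) → Bool :=
    Quot.lift (fun d => xor (decide (o d = 1)) (O.out d)) (by
      rintro ⟨c, i⟩ d' (rfl | rfl)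
      · rw [O.out_pair, hflip _ _ (ho _)]
        simp
      · rw [O.out_splice]
        have : o (splice (allA C) (c, i)) = o (c, i) + 1 := hsplice c i
        rw [hflip _ _ this]
        simp)
  have h1 : q (P.circleAt _ (c, i + 1)) = q (P.circleAt _ (c, i)) :=
    congrArg q (Subsingleton.elim (P.circleAt (allA C) _) (P.circleAt (allA C) _))
  change xor (decide (o (c, i + 1) = 1)) (O.out (c, i + 1)) =
    xor (decide (o (c, i) = 1)) (O.out (c, i)) at h1
  rw [hflip _ _ (ho' c i)] at h1
  revert h1
  cases decide (o (c, i) = 1) <;> cases O.out (c, i) <;> cases O.out (c, i + 1) <;> simp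

theorem splice_splice_self (s : C → Bool) (d : C × ZMod 4) : splice s (splice s d) = d := by
  unfold splice
  split_ifs <;> simp

/-- Replacing the `A`-splicing by the `B`-splicing moves an end to the other arc of the
crossing. -/
theorem arc_splice_eq_flipOn (s : C → Bool) (d : C × ZMod 4) :
    arc (splice s d) = Dessin.flipOn {c | s c = false} (arc d) := by
  obtain ⟨c, i⟩ := d
  have h1 : ∀ i : ZMod 4, decide (1 - i = 2 ∨ 1 - i = 3) = decide (i = 2 ∨ i = 3) := by decide
  have h2 : ∀ i : ZMod 4, decide (3 - i = 2 ∨ 3 - i = 3) = !decide (i = 2 ∨ i = 3) := by decide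
  simp only [arc]
  cases h : s c
  · rw [Dessin.flipOn_of_mem (by simpa using h)]
    simp only [splice, h, Bool.false_eq_true, if_false]
    rw [h2]
  · rw [Dessin.flipOn_of_notMem (by simp [h])]
    simp only [splice, h, if_true]
    rw [h1]

section Alternating

variable {O : P.CircleOrientation} (hO : ∀ c i, O.out (c, i + 1) = !O.out (c, i)) (s : C → Bool)
include hO

theorem out_splice_of_alternating (d : C × ZMod 4) : O.out (splice s d) = !O.out d := by
  cases h : s d.1
  · obtain ⟨c, i⟩ := d
    have hc : s c = false := h
    have h2 : ∀ j : ZMod 4, O.out (c, j + 2) = O.out (c, j) := fun j => by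
      have : j + 2 = (j + 1) + 1 := by ring
      rw [this, hO, hO, Bool.not_not]
    have hi : 3 - i = (1 - i) + 2 := by ring
    have h3 : splice s (c, i) = (c, 3 - i) := by simp [splice, hc]
    rw [h3, hi, h2, ← O.out_splice]
    rfl
  · rw [← O.out_splice]
    congr 1
    simp [splice, h, allA]

theorem splice_pair_endOf (a : C × Bool) :
    splice s (P.pair (O.endOf true a)) =
      O.endOf true ((Dessin.flipOn {c | s c = false} * O.nextArc) a) := by
  have h1 : O.out (splice s (P.pair (O.endOf true a))) = true := by
    rw [out_splice_of_alternating hO, O.out_pair, O.out_endOf]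
    rfl
  have h2 := O.endOf_arc (splice s (P.pair (O.endOf true a)))
  rw [h1, arc_splice_eq_flipOn] at h2
  exact h2.symm

/-- If the direction of the all-`A` circle alternates around the crossings, it directs the circles
of every state; these are the cycles of the boundary walk in the all-`A` dessin. -/
theorem sameCycle_iff_circleAt_eq (a b : C × Bool) :
    (Dessin.flipOn {c | s c = false} * O.nextArc).SameCycle a b ↔
      P.circleAt s (O.endOf true a) = P.circleAt s (O.endOf true b) := by
  set ψ := Dessin.flipOn {c | s c = false} * O.nextArc with hψ
  have hstep : ∀ a, P.circleAt s (O.endOf true (ψ a)) = P.circleAt s (O.endOf true a) := by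
    intro a
    rw [hψ, ← splice_pair_endOf hO, circleAt_splice, circleAt_pair]
  constructor
  · rintro ⟨n, rfl⟩
    induction n with
    | zero => rfl
    | succ n ih => rw [add_comm, zpow_one_add, Equiv.Perm.mul_apply, hstep, ← ih]
    | pred n ih =>
      rw [ih, ← hstep ((ψ ^ (-(n : ℤ) - 1)) a), ← Equiv.Perm.mul_apply, ← zpow_one_add,
        add_sub_cancel]
  · intro h
    let r : C × ZMod 4 → C × Bool := fun d => if O.out d then arc d else arc (splice s d)
    have hpair : ∀ d, O.out d = true → ψ.SameCycle (r d) (r (P.pair d)) := by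
      intro d hd
      have h2 : O.out (P.pair d) = false := by rw [O.out_pair, hd]; rfl
      refine ⟨1, ?_⟩
      have h3 := splice_pair_endOf hO s (arc d)
      rw [← hd, O.endOf_arc, hd] at h3
      simp only [r, hd, h2, if_true, Bool.false_eq_true, if_false, zpow_one]
      rw [h3, O.arc_endOf]
    let q : P.Circle s → Quotient (Equiv.Perm.SameCycle.setoid ψ) :=
      Quot.lift (fun d => Quotient.mk _ (r d)) (by
        rintro d d' (rfl | rfl)
        · cases hd : O.out d
          · have h2 := hpair (P.pair d) (by rw [O.out_pair, hd]; rfl)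
            rw [P.pair_pair] at h2
            exact Quotient.sound h2.symm
          · exact Quotient.sound (hpair d hd)
        · congr 1
          have h2 := out_splice_of_alternating hO s d
          cases hd : O.out d <;> simp [r, hd, h2, splice_splice_self])
    have hr : ∀ a, r (O.endOf true a) = a := fun a => by
      simp only [r, O.out_endOf, if_true, O.arc_endOf]
    have h2 : q (P.circleAt _ (O.endOf true a)) = q (P.circleAt _ (O.endOf true b)) :=
      congrArg q h
    change Quotient.mk _ (r _) = Quotient.mk _ (r _) at h2
    rw [hr, hr] at h2
    exact Quotient.exact h2

theorem exists_circleAt_endOf_eq (x : P.Circle s) : ∃ a, P.circleAt s (O.endOf true a) = x := by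
  induction x using Quot.inductionOn with | _ d =>
  cases hd : O.out d
  · refine ⟨arc (splice s d), ?_⟩
    have h2 : O.out (splice s d) = true := by rw [out_splice_of_alternating hO, hd]; rfl
    rw [← h2, O.endOf_arc]
    exact P.circleAt_splice s d
  · refine ⟨arc d, ?_⟩
    rw [← hd, O.endOf_arc]
    rfl

theorem subsingleton_circle_iff :
    Subsingleton (P.Circle s) ↔ (P.allADessin O).Unicursal {c | s c = false} := by
  rw [Dessin.unicursal_iff_sameCycle_flipOn_mul_rot]
  change _ ↔ ∀ h h', (Dessin.flipOn {c | s c = false} * O.nextArc).SameCycle h h'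
  simp only [sameCycle_iff_circleAt_eq hO]
  constructor
  · intro h a b
    exact Subsingleton.elim _ _
  · intro h
    refine ⟨fun x y => ?_⟩
    obtain ⟨a, rfl⟩ := exists_circleAt_endOf_eq hO s x
    obtain ⟨b, rfl⟩ := exists_circleAt_endOf_eq hO s y
    exact h a b

end Alternating

theorem circles_sub_one_eq_zero_iff [Finite C] {O : P.CircleOrientation}
    (hv : (P.allADessin O).v = 1) (s : C → Bool) :
    P.circles s - 1 = 0 ↔ (P.allADessin O).Unicursal {c | s c = false} := by
  have hfin : ∀ t, Finite (P.Circle t) := fun t => Finite.of_surjective _ (Quot.mk_surjective)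
  have := hfin s
  have := hfin (allA C)
  have hv' : Nat.card (P.Circle (allA C)) + P.loops = 1 := by
    rw [← Nat.card_fin P.loops, ← Nat.card_sum]
    exact hv
  have : Subsingleton (P.Circle (allA C)) := by
    rw [← Finite.card_le_one_iff_subsingleton]
    omega
  rw [← subsingleton_circle_iff O.out_add_one, ← Finite.card_le_one_iff_subsingleton, circles]
  rcases isEmpty_or_nonempty C with hC | hC
  · have h0 : ∀ t, IsEmpty (P.Circle t) := fun t => ⟨fun x => Quot.inductionOn x fun d =>
      isEmptyElim d.1⟩
    have := h0 s
    have := h0 (allA C)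
    simp only [Nat.card_of_isEmpty] at hv' ⊢
    omega
  · have : Nonempty (P.Circle (allA C)) := ⟨P.circleAt _ (Classical.arbitrary C, 0)⟩
    have : 0 < Nat.card (P.Circle (allA C)) := Nat.card_pos
    omega

end LinkDiagram

/-! ### The bracket at `exp (π i / 4)` -/

namespace LinkDiagram

theorem rootA_sq : (rootA : ℂ) ^ 2 = Complex.I := by
  change Complex.exp (Real.pi * Complex.I / 4) ^ 2 = _
  have h : ((2 : ℕ) : ℂ) * (Real.pi * Complex.I / 4) = Real.pi / 2 * Complex.I := by
    push_cast
    ring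
  rw [← Complex.exp_nat_mul, h, Complex.exp_pi_div_two_mul_I]

theorem norm_rootA : ‖(rootA : ℂ)‖ = 1 := by
  have h : ‖(rootA : ℂ)‖ ^ 2 = 1 := by rw [← norm_pow, rootA_sq, Complex.norm_I]
  exact (pow_eq_one_iff_of_nonneg (norm_nonneg _) two_ne_zero).mp h

theorem norm_rootA_zpow (n : ℤ) : ‖((rootA ^ n : ℂˣ) : ℂ)‖ = 1 := by
  rw [Units.val_zpow_eq_zpow_val, norm_zpow, norm_rootA, one_zpow]

variable {C : Type*} [Fintype C]

open LaurentPolynomial in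
/-- The factor of a circle vanishes at `A = exp (π i / 4)`. -/
theorem eval_circle_factor :
    LaurentPolynomial.eval₂ (Int.castRingHom ℂ) rootA (-T 2 - T (-2)) = 0 := by
  rw [map_sub, map_neg, eval₂_T, eval₂_T, Units.val_zpow_eq_zpow_val, Units.val_zpow_eq_zpow_val,
    zpow_neg, zpow_ofNat, rootA_sq, Complex.inv_I]
  ring

theorem determinant_eq_norm_bracket [DecidableEq C] (P : LinkDiagram C) :
    P.determinant = ‖LaurentPolynomial.eval₂ (Int.castRingHom ℂ) rootA P.bracket‖ := by
  rw [determinant, jones, map_mul, map_mul, norm_mul, norm_mul, LaurentPolynomial.eval₂_T,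
    norm_rootA_zpow, LaurentPolynomial.eval₂_C]
  rcases Int.units_eq_one_or (Int.negOnePow P.writhe) with h | h <;> simp [h]

/-- The states of a diagram, given by the set of crossings with `B`-splicing. -/
def stateEquiv (C : Type*) [Fintype C] [DecidableEq C] : Finset C ≃ (C → Bool) where
  toFun S c := decide (c ∉ S)
  invFun s := Finset.univ.filter fun c => s c = false
  left_inv S := by ext c; simp
  right_inv s := by ext c; cases h : s c <;> simp [h]

theorem sum_stateEquiv [DecidableEq C] (S : Finset C) :
    (∑ c, if stateEquiv C S c then (1 : ℤ) else -1) = Fintype.card C - 2 * S.card := by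
  have h1 : ∀ c, (if stateEquiv C S c then (1 : ℤ) else -1) = 1 - 2 * if c ∈ S then 1 else 0 := by
    intro c
    by_cases hc : c ∈ S <;> simp [stateEquiv, hc]
  simp_rw [h1]
  simp [mul_comm]

open Classical in
/-- At `A = exp (π i / 4)` only the states with a single circle contribute to the bracket. -/
theorem eval_bracket [DecidableEq C] {P : LinkDiagram C} {O : P.CircleOrientation}
    (hv : (P.allADessin O).v = 1) :
    LaurentPolynomial.eval₂ (Int.castRingHom ℂ) rootA P.bracket =
      (rootA : ℂ) ^ Fintype.card C *
        ∑ S : Finset C, if (P.allADessin O).Unicursal S then (-1) ^ (S.card / 2) else 0 := by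
  have hA := rootA.ne_zero
  rw [bracket, map_sum, ← (stateEquiv C).sum_comp, Finset.mul_sum]
  refine Finset.sum_congr rfl fun S _ => ?_
  have hS : {c | stateEquiv C S c = false} = (S : Set C) := by
    ext c
    simp [stateEquiv]
  rw [map_mul, map_pow, eval_circle_factor, LaurentPolynomial.eval₂_T, sum_stateEquiv, zero_pow_eq,
    Units.val_zpow_eq_zpow_val]
  simp only [circles_sub_one_eq_zero_iff hv, hS, mul_ite, mul_one, mul_zero]
  split_ifs with hU
  · obtain ⟨r, hr⟩ := hU.even_card hv
    have h2 : S.card / 2 = r := by omega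
    have h3 : (rootA : ℂ) ^ 4 = -1 := by
      rw [show 4 = 2 * 2 from rfl, pow_mul, rootA_sq, Complex.I_sq]
    have h4 : (2 * (S.card : ℤ)) = ((4 * r : ℕ) : ℤ) := by
      rw [hr]
      push_cast
      ring
    rw [h2, zpow_sub₀ hA, h4, zpow_natCast, zpow_natCast, pow_mul, h3, div_eq_mul_inv, ← inv_pow,
      inv_neg_one]
  · rfl

open Classical in
theorem determinant_eq_norm_det_IM [DecidableEq C] {P : LinkDiagram C} {O : P.CircleOrientation}
    (hv : (P.allADessin O).v = 1) (N : (P.allADessin O).ChordNumbering) :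
    P.determinant =
      ‖(N.IM.map (Int.cast : ℤ → ℂ) - Complex.I • (1 : Matrix _ _ ℂ)).det‖ := by
  have h1 : (N.IM.map (Int.cast : ℤ → ℂ) - Complex.I • (1 : Matrix _ _ ℂ)).det =
      (-Complex.I) ^ Fintype.card C *
        ∑ S : Finset C, if (P.allADessin O).Unicursal S then (-1) ^ (S.card / 2) else 0 := by
    rw [N.det_IM_sub_smul_one, Finset.mul_sum]
    refine Finset.sum_congr rfl fun S _ => ?_
    rw [mul_ite, mul_zero]
    split_ifs with hU
    · obtain ⟨r, hr⟩ := hU.even_card hv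
      have h2 : S.card / 2 = r := by omega
      have h3 := S.card_le_univ
      have h4 : Fintype.card C = (Fintype.card C - S.card) + 2 * r := by omega
      have h5 : (-Complex.I) ^ 2 = -1 := by rw [neg_sq, Complex.I_sq]
      conv_rhs => rw [h4, pow_add, pow_mul, h5, h2, mul_assoc, ← mul_pow, neg_one_mul, neg_neg,
        one_pow, mul_one]
      rw [Nat.card_eq_fintype_card]
    · rfl
  rw [determinant_eq_norm_bracket, eval_bracket hv, h1, norm_mul, norm_mul, norm_pow, norm_pow,
    norm_rootA, norm_neg, Complex.norm_I]

end LinkDiagram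

end

theorem mainTheorem3 :
    (∀ {V E : Type*} [Finite E] (D : Dessin V E), D.v = 1 → ∀ N : D.ChordNumbering,
      (N.IM.map Polynomial.C - (Polynomial.X : ℤ[X]) • (1 : Matrix _ _ ℤ[X])).det =
        (-1) ^ D.e * ∑ j ∈ Finset.range (D.e / 2 + 1),
          (D.s j : ℤ[X]) * Polynomial.X ^ (D.e - 2 * j)) ∧
    (∀ {C : Type*} [Fintype C] [DecidableEq C] (P : LinkDiagram C), P.IsConnected →
      ∀ O : P.CircleOrientation, (P.allADessin O).v = 1 →
        ∀ N : (P.allADessin O).ChordNumbering,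
          P.determinant =
            ‖(N.IM.map (Int.cast : ℤ → ℂ) - Complex.I • (1 : Matrix _ _ ℂ)).det‖) :=
  ⟨fun _ hv N => Dessin.det_IM_sub_X hv N,
    fun _ _ _ hv N => LinkDiagram.determinant_eq_norm_det_IM hv N⟩
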